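/- Let $N \ge 2$ be an integer and let $U$ be a random $N\times N$ unitary matrix distributed according to the Haar probability measure on the unitary group $\mathrm{U}(N)$. Then for all $1\le i,j\le N$ the random variable $p_{ij} := |U_{ij}|^2$ has the $\mathrm{Beta}(1,N-1)$ distribution; that is, its law on $\mathbb{R}$ is absolutely continuous with respect to Lebesgue measure, with density $$p \mapsto (N-1)(1-p)^{N-2}\,\mathbf{1}_{0\le p\le 1}.$$ -/

import Mathlib

open MeasureTheory ProbabilityTheory

/-! Let `w` be a standard complex Gaussian vector independent of `U`. For fixed `w ≠ 0`, left
invariance and transitivity of the unitary group on spheres give `|(Uᴴ w)_j|² / ‖w‖²` the law of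
`|U_ij|²`. For fixed `U`, unitary invariance of the Gaussian gives it the law of `|w_j|² / ‖w‖²`. So
Tonelli (`lintegral_exp_mul_haar_unitaryGroup_lt_norm_sq`) reduces the tail to a Gaussian one. There
`|w_j|²` is exponential and independent of the other coordinates, which yields `(1 - t) ^ (N - 1)`
(`setLIntegral_exp_neg_sum_norm_sq_cone`), and this tail characterizes the Beta law
(`eq_betaMeasure_one_sub_one_of_Ioi`). -/

/-! ### Gaussian integrals -/

/-- The Gaussian integral over `ℂⁿ`. -/
theorem lintegral_exp_neg_mul_sum_norm_sq (n : ℕ) {c : ℝ} (hc : 0 < c) :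
    ∫⁻ w : Fin n → ℂ, ENNReal.ofReal (Real.exp (-c * ∑ k, ‖w k‖ ^ 2))
      = ENNReal.ofReal ((Real.pi / c) ^ n) := by
  have h1 : ∫ z : ℂ, Real.exp (-c * ‖z‖ ^ 2) = Real.pi / c := by
    have := Complex.integral_exp_neg_mul_rpow (p := 2) (by norm_num) hc
    simp only [Real.rpow_ofNat] at this
    rw [this]
    norm_num [Real.rpow_neg_one, div_eq_mul_inv]
  have hpi : 0 < Real.pi / c := div_pos Real.pi_pos hc
  -- A non-integrable function has integral `0` by convention, so the positive value forces
  -- integrability.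
  have hint : Integrable fun z : ℂ => Real.exp (-c * ‖z‖ ^ 2) :=
    not_imp_comm.1 integral_undef (by rw [h1]; exact hpi.ne')
  have hexp (w : Fin n → ℂ) : Real.exp (-c * ∑ k, ‖w k‖ ^ 2)
      = ∏ k, Real.exp (-c * ‖w k‖ ^ 2) := by
    rw [Finset.mul_sum, Real.exp_sum]
  simp_rw [hexp]
  rw [← ofReal_integral_eq_lintegral_ofReal]
  · rw [integral_fintype_prod_volume_eq_pow (fun z : ℂ => Real.exp (-c * ‖z‖ ^ 2)), h1,
      Fintype.card_fin]
  · exact Integrable.fintype_prod (f := fun _ z => Real.exp (-c * ‖z‖ ^ 2)) fun _ => hint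
  · exact Filter.Eventually.of_forall fun w => Finset.prod_nonneg fun k _ => (Real.exp_pos _).le

theorem lintegral_Ioi_mul_exp_neg_sq {b : ℝ} (hb : 0 ≤ b) :
    ∫⁻ r in Set.Ioi b, ENNReal.ofReal (r * Real.exp (-r ^ 2))
      = ENNReal.ofReal (Real.exp (-b ^ 2) / 2) := by
  have hd (r : ℝ) : HasDerivAt (fun x : ℝ => -Real.exp (-x ^ 2) / 2) (r * Real.exp (-r ^ 2)) r := by
    have := (((hasDerivAt_pow 2 r).neg.exp).neg).div_const 2
    exact this.congr_deriv (by simp; ring)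
  have hlim : Filter.Tendsto (fun x : ℝ => -Real.exp (-x ^ 2) / 2) Filter.atTop (nhds 0) := by
    have h : Filter.Tendsto (fun x : ℝ => Real.exp (-x ^ 2)) Filter.atTop (nhds 0) :=
      Real.tendsto_exp_neg_atTop_nhds_zero.comp (Filter.tendsto_pow_atTop two_ne_zero)
    simpa using h.neg.div_const 2
  have hpos : ∀ r ∈ Set.Ioi b, 0 ≤ r * Real.exp (-r ^ 2) := fun r hr =>
    mul_nonneg (hb.trans (le_of_lt hr)) (Real.exp_pos _).le
  rw [← ofReal_integral_eq_lintegral_ofReal]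
  · rw [integral_Ioi_of_hasDerivAt_of_nonneg' (fun r _ => hd r) hpos hlim]
    congr 1
    ring
  · exact integrableOn_Ioi_deriv_of_nonneg' (fun r _ => hd r) hpos hlim
  · exact (ae_restrict_iff' measurableSet_Ioi).2 (Filter.Eventually.of_forall hpos)

/-- The tail of the planar Gaussian: its squared modulus is exponentially distributed. -/
theorem setLIntegral_exp_neg_norm_sq_of_lt {a : ℝ} (ha : 0 ≤ a) :
    ∫⁻ z in {z : ℂ | a < ‖z‖ ^ 2}, ENNReal.ofReal (Real.exp (-‖z‖ ^ 2))
      = ENNReal.ofReal (Real.pi * Real.exp (-a)) := by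
  have hS : MeasurableSet {z : ℂ | a < ‖z‖ ^ 2} :=
    measurableSet_lt measurable_const (by fun_prop)
  rw [← lintegral_indicator hS, ← Complex.lintegral_comp_polarCoord_symm]
  have hpt : ∀ p ∈ polarCoord.target, ENNReal.ofReal p.1 •
      ({z : ℂ | a < ‖z‖ ^ 2}.indicator (fun z => ENNReal.ofReal (Real.exp (-‖z‖ ^ 2)))
        (Complex.polarCoord.symm p)) = (Set.Ioi √a).indicator
        (fun r => ENNReal.ofReal (r * Real.exp (-r ^ 2))) p.1 * 1 := by
    rintro ⟨r, θ⟩ hp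
    have hr : 0 < r := hp.1
    have hiff : a < r ^ 2 ↔ √a < r := (Real.sqrt_lt' hr).symm
    by_cases h : √a < r
    · have h' := hiff.2 h
      simp [Set.indicator, h, h', ENNReal.ofReal_mul hr.le, abs_of_pos hr]
    · have h' := mt hiff.1 h
      simp [Set.indicator, h, h']
  rw [setLIntegral_congr_fun polarCoord.open_target.measurableSet hpt, polarCoord_target,
    Measure.volume_eq_prod, ← Measure.prod_restrict,
    lintegral_prod_mul (f := (Set.Ioi √a).indicator
        (fun r => ENNReal.ofReal (r * Real.exp (-r ^ 2)))) (g := fun _ => 1)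
      (Measurable.aemeasurable (by
        refine Measurable.indicator (by fun_prop) measurableSet_Ioi)) (by fun_prop)]
  rw [lintegral_indicator measurableSet_Ioi, Measure.restrict_restrict measurableSet_Ioi,
    Set.inter_eq_left.2 (Set.Ioi_subset_Ioi (Real.sqrt_nonneg a)),
    lintegral_Ioi_mul_exp_neg_sq (Real.sqrt_nonneg a), Real.sq_sqrt ha]
  simp only [lintegral_const, one_mul, Measure.restrict_apply_univ, Real.volume_Ioo]
  rw [← ENNReal.ofReal_mul (by positivity)]
  congr 1
  ring

/-- Under the Gaussian measure on `ℂⁿ⁺¹`, the squared modulus of a coordinate exceeds the fraction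
`t` of the squared norm with probability `(1 - t) ^ n`. -/
theorem setLIntegral_exp_neg_sum_norm_sq_cone (n : ℕ) (j : Fin (n + 1)) {t : ℝ} (ht : 0 ≤ t)
    (ht1 : t < 1) :
    ∫⁻ w in {w : Fin (n + 1) → ℂ | t * ∑ k, ‖w k‖ ^ 2 < ‖w j‖ ^ 2},
      ENNReal.ofReal (Real.exp (-∑ k, ‖w k‖ ^ 2))
      = ENNReal.ofReal (Real.pi ^ (n + 1) * (1 - t) ^ n) := by
  have h1t : 0 < 1 - t := by linarith
  -- Solving the cone inequality for `‖w j‖ ^ 2` gives the threshold `s * q`. The exponential tail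
  -- then contributes `exp (-s * q)`, turning the remaining Gaussian weight into `exp (-(1 + s) *
  -- q)`.
  set s := t / (1 - t) with hs
  have hs0 : 0 ≤ s := div_nonneg ht h1t.le
  have hs1 : 1 + s = (1 - t)⁻¹ := by rw [hs]; field_simp; ring
  have hS : MeasurableSet {w : Fin (n + 1) → ℂ | t * ∑ k, ‖w k‖ ^ 2 < ‖w j‖ ^ 2} :=
    measurableSet_lt (by fun_prop) (by fun_prop)
  let q : (Fin n → ℂ) → ℝ := fun u => ∑ k, ‖u k‖ ^ 2
  have hq0 (u) : 0 ≤ q u := Finset.sum_nonneg fun k _ => by positivity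
  have hq : Measurable q := by fun_prop
  let F : ℂ × (Fin n → ℂ) → ENNReal := fun p =>
    {p : ℂ × (Fin n → ℂ) | s * q p.2 < ‖p.1‖ ^ 2}.indicator
      (fun p => ENNReal.ofReal (Real.exp (-‖p.1‖ ^ 2)) * ENNReal.ofReal (Real.exp (-q p.2))) p
  have hF : Measurable F := by
    refine Measurable.indicator (by fun_prop) (measurableSet_lt (by fun_prop) (by fun_prop))
  have hpt (w : Fin (n + 1) → ℂ) :
      {w : Fin (n + 1) → ℂ | t * ∑ k, ‖w k‖ ^ 2 < ‖w j‖ ^ 2}.indicator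
        (fun w => ENNReal.ofReal (Real.exp (-∑ k, ‖w k‖ ^ 2))) w
      = F (MeasurableEquiv.piFinSuccAbove (fun _ => ℂ) j w) := by
    have hsum : ∑ k, ‖w k‖ ^ 2 = ‖w j‖ ^ 2 + q (j.removeNth w) := Fin.sum_univ_succAbove _ j
    have hiff : t * (‖w j‖ ^ 2 + q (j.removeNth w)) < ‖w j‖ ^ 2 ↔
        s * q (j.removeNth w) < ‖w j‖ ^ 2 := by
      rw [hs, div_mul_eq_mul_div, div_lt_iff₀ h1t]
      constructor <;> intro h <;> linarith
    have he : MeasurableEquiv.piFinSuccAbove (fun _ => ℂ) j w = (w j, j.removeNth w) := rfl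
    rw [he]
    by_cases h : s * q (j.removeNth w) < ‖w j‖ ^ 2
    · have h' := hiff.2 h
      simp only [F, Set.indicator, Set.mem_ofPred_eq, hsum, h, h', if_true]
      rw [neg_add, Real.exp_add, ENNReal.ofReal_mul (Real.exp_pos _).le]
    · have h' := mt hiff.1 h
      simp only [F, Set.indicator, Set.mem_ofPred_eq, hsum, h, h', if_false]
  rw [← lintegral_indicator hS]
  simp_rw [hpt]
  rw [(volume_preserving_piFinSuccAbove (fun _ : Fin (n + 1) => ℂ) j).lintegral_comp hF,
    Measure.volume_eq_prod, lintegral_prod_symm' F hF]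
  have hinner (u : Fin n → ℂ) : ∫⁻ z, F (z, u)
      = ENNReal.ofReal Real.pi * ENNReal.ofReal (Real.exp (-(1 + s) * q u)) := by
    have hSu : MeasurableSet {z : ℂ | s * q u < ‖z‖ ^ 2} :=
      measurableSet_lt (by fun_prop) (by fun_prop)
    have : (fun z => F (z, u)) = fun z => {z : ℂ | s * q u < ‖z‖ ^ 2}.indicator
        (fun z => ENNReal.ofReal (Real.exp (-‖z‖ ^ 2))) z * ENNReal.ofReal (Real.exp (-q u)) := by
      ext z
      by_cases h : s * q u < ‖z‖ ^ 2 <;> simp [F, Set.indicator, h]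
    rw [this, lintegral_mul_const _ (Measurable.indicator (by fun_prop) hSu),
      lintegral_indicator hSu, setLIntegral_exp_neg_norm_sq_of_lt (mul_nonneg hs0 (hq0 u)),
      ← ENNReal.ofReal_mul (by positivity), ← ENNReal.ofReal_mul (by positivity), mul_assoc,
      ← Real.exp_add]
    congr 3
    ring
  simp_rw [hinner]
  rw [lintegral_const_mul _ (by fun_prop),
    lintegral_exp_neg_mul_sum_norm_sq n (c := 1 + s) (by positivity),
    ← ENNReal.ofReal_mul (by positivity), hs1]
  congr 1
  rw [div_inv_eq_mul, mul_pow]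
  ring

/-! ### Unitary action on `ℂᴺ` -/

theorem sum_norm_sq_unitary_mulVec {N : ℕ} (V : Matrix.unitaryGroup (Fin N) ℂ) (w : Fin N → ℂ) :
    ∑ k, ‖((V : Matrix (Fin N) (Fin N) ℂ).mulVec w) k‖ ^ 2 = ∑ k, ‖w k‖ ^ 2 := by
  have h (u : Fin N → ℂ) : ((∑ k, ‖u k‖ ^ 2 : ℝ) : ℂ) = star u ⬝ᵥ u := by
    push_cast
    exact Finset.sum_congr rfl fun k _ => (Complex.conj_mul' (u k)).symm
  have hV : (V : Matrix (Fin N) (Fin N) ℂ).conjTranspose * V = 1 :=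
    Matrix.UnitaryGroup.star_mul_self V
  rw [← Complex.ofReal_inj, h, h, Matrix.star_mulVec, ← Matrix.dotProduct_mulVec,
    Matrix.mulVec_mulVec, hV, Matrix.one_mulVec]

/-- The real determinant of a complex linear map is the squared modulus of its complex determinant,
here `1`. -/
theorem measurePreserving_unitary_mulVec {N : ℕ} (V : Matrix.unitaryGroup (Fin N) ℂ) :
    MeasurePreserving fun w : Fin N → ℂ => (V : Matrix (Fin N) (Fin N) ℂ).mulVec w := by
  let f : (Fin N → ℂ) →ₗ[ℝ] (Fin N → ℂ) :=
    (Matrix.toLin' (V : Matrix (Fin N) (Fin N) ℂ)).restrictScalars ℝ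
  have hdet : LinearMap.det f = 1 := by
    have h1 : star (Matrix.det (V : Matrix (Fin N) (Fin N) ℂ)) * Matrix.det V.1 = 1 :=
      (Matrix.det_of_mem_unitary V.2).1
    rw [LinearMap.det_restrictScalars, LinearMap.det_toLin', Algebra.norm_complex_apply,
      ← Complex.ofReal_inj, Complex.normSq_eq_conj_mul_self]
    exact_mod_cast h1
  have hf : Measurable f := f.continuous_of_finiteDimensional.measurable
  refine ⟨hf, ?_⟩
  have := Measure.map_linearMap_addHaar_eq_smul_addHaar (volume : Measure (Fin N → ℂ))
    (f := f) (by rw [hdet]; exact one_ne_zero)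
  rw [hdet, inv_one, abs_one, ENNReal.ofReal_one, one_smul] at this
  exact this

/-- Every vector is the image of a multiple of a basis vector under a unitary matrix. -/
theorem exists_unitary_mulVec_single {N : ℕ} (w : Fin N → ℂ) (i : Fin N) :
    ∃ V : Matrix.unitaryGroup (Fin N) ℂ, (V : Matrix (Fin N) (Fin N) ℂ).mulVec
      (Pi.single i ((√(∑ k, ‖w k‖ ^ 2) : ℝ) : ℂ)) = w := by
  by_cases hw : w = 0
  · exact ⟨1, by simp [hw]⟩
  let x : EuclideanSpace ℂ (Fin N) := WithLp.toLp 2 w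
  have hx : ‖x‖ = √(∑ k, ‖w k‖ ^ 2) := EuclideanSpace.norm_eq x
  have hx0 : x ≠ 0 := fun h => hw (by simpa [x] using h)
  have hxn : (‖x‖ : ℂ) ≠ 0 := by exact_mod_cast norm_ne_zero_iff.2 hx0
  have hon : Orthonormal ℂ (({i} : Set (Fin N)).domRestrict
      fun _ => ((‖x‖ : ℂ)⁻¹ • x : EuclideanSpace ℂ (Fin N))) := by
    refine ⟨fun _ => ?_, fun a b hab => absurd (Subsingleton.elim a b) hab⟩
    have := norm_ne_zero_iff.2 hx0
    simp [Set.domRestrict, norm_smul, this]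
  -- Extend `w / ‖w‖`, placed at index `i`, to an orthonormal basis; its vectors are the columns of
  -- `V`.
  obtain ⟨b, hb⟩ := hon.exists_orthonormalBasis_extension_of_card_eq (by simp)
  refine ⟨⟨_, (EuclideanSpace.basisFun (Fin N) ℂ).toMatrix_orthonormalBasis_mem_unitary b⟩, ?_⟩
  ext k
  have hbk : (b i) k = (‖x‖ : ℂ)⁻¹ * w k := by rw [hb i rfl]; simp [x]
  rw [← hx]
  simp [Module.Basis.toMatrix_apply, hbk]
  field_simp

/-! ### Transfer from Haar to Gaussian measure -/

theorem measurable_unitaryGroup_apply {N : ℕ} [MeasurableSpace (Matrix.unitaryGroup (Fin N) ℂ)]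
    [BorelSpace (Matrix.unitaryGroup (Fin N) ℂ)] (i j : Fin N) :
    Measurable fun U : Matrix.unitaryGroup (Fin N) ℂ => (U : Matrix (Fin N) (Fin N) ℂ) i j :=
  (continuous_subtype_val.matrix_elem i j).measurable

/-- By left invariance, the law of a coordinate of `Uᴴ w` depends on `w` only through its norm. -/
theorem haar_unitaryGroup_lt_norm_sq_conjTranspose_mulVec {N : ℕ}
    [MeasurableSpace (Matrix.unitaryGroup (Fin N) ℂ)]
    [BorelSpace (Matrix.unitaryGroup (Fin N) ℂ)]
    (μ : Measure (Matrix.unitaryGroup (Fin N) ℂ)) [μ.IsMulLeftInvariant]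
    (i j : Fin N) (t : ℝ) {w : Fin N → ℂ} (hw : w ≠ 0) :
    μ {U | t * ∑ k, ‖w k‖ ^ 2
        < ‖((U : Matrix (Fin N) (Fin N) ℂ).conjTranspose.mulVec w) j‖ ^ 2}
      = μ {U | t < ‖(U : Matrix (Fin N) (Fin N) ℂ) i j‖ ^ 2} := by
  obtain ⟨V, hV⟩ := exists_unitary_mulVec_single w i
  have hr : 0 < ∑ k, ‖w k‖ ^ 2 := by
    obtain ⟨k, hk⟩ := Function.ne_iff.1 hw
    exact Finset.sum_pos' (fun _ _ => by positivity)
      ⟨k, Finset.mem_univ k, by have := norm_pos_iff.2 hk; positivity⟩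
  set r := ∑ k, ‖w k‖ ^ 2 with hr_def
  -- Replace `U` by `V * U`: then `(V U)ᴴ w = Uᴴ Vᴴ w = √r • Uᴴ e_i`.
  rw [← measure_preimage_mul μ V]
  congr 1
  ext U
  have hVV : (V : Matrix (Fin N) (Fin N) ℂ).conjTranspose * V = 1 :=
    Matrix.UnitaryGroup.star_mul_self V
  have h : (((V * U : Matrix.unitaryGroup (Fin N) ℂ) :
      Matrix (Fin N) (Fin N) ℂ).conjTranspose.mulVec w) j
      = star ((U : Matrix (Fin N) (Fin N) ℂ) i j) * ((√r : ℝ) : ℂ) := by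
    rw [Matrix.UnitaryGroup.mul_val, Matrix.conjTranspose_mul]
    nth_rewrite 1 [← hV]
    rw [Matrix.mulVec_mulVec, Matrix.mul_assoc, hVV, Matrix.mul_one]
    simp [Matrix.mulVec_single]
  simp only [Set.mem_preimage, Set.mem_ofPred_eq, h]
  rw [norm_mul, norm_star, mul_pow, Complex.norm_real, Real.norm_eq_abs, sq_abs,
    Real.sq_sqrt hr.le, mul_lt_mul_iff_left₀ hr]

/-- Averaging over an auxiliary Gaussian vector transfers the tail of `‖U i j‖ ^ 2` to the tail
of the normalized coordinate of that vector. -/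
theorem lintegral_exp_mul_haar_unitaryGroup_lt_norm_sq {N : ℕ}
    [MeasurableSpace (Matrix.unitaryGroup (Fin N) ℂ)]
    [BorelSpace (Matrix.unitaryGroup (Fin N) ℂ)]
    (μ : Measure (Matrix.unitaryGroup (Fin N) ℂ)) [μ.IsMulLeftInvariant] [IsProbabilityMeasure μ]
    (i j : Fin N) (t : ℝ) :
    (∫⁻ w : Fin N → ℂ, ENNReal.ofReal (Real.exp (-∑ k, ‖w k‖ ^ 2)))
        * μ {U | t < ‖(U : Matrix (Fin N) (Fin N) ℂ) i j‖ ^ 2}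
      = ∫⁻ w in {w : Fin N → ℂ | t * ∑ k, ‖w k‖ ^ 2 < ‖w j‖ ^ 2},
          ENNReal.ofReal (Real.exp (-∑ k, ‖w k‖ ^ 2)) := by
  let g : (Fin N → ℂ) → ENNReal := fun w => ENNReal.ofReal (Real.exp (-∑ k, ‖w k‖ ^ 2))
  have hg : Measurable g := by fun_prop
  let ν : Measure (Fin N → ℂ) := volume.withDensity g
  let S : Set (Matrix.unitaryGroup (Fin N) ℂ × (Fin N → ℂ)) :=
    {p | t * ∑ k, ‖p.2 k‖ ^ 2
      < ‖((p.1 : Matrix (Fin N) (Fin N) ℂ).conjTranspose.mulVec p.2) j‖ ^ 2}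
  have hS : MeasurableSet S := by
    refine measurableSet_lt (by fun_prop) ((Measurable.norm ?_).pow_const 2)
    simp only [Matrix.mulVec, dotProduct, Matrix.conjTranspose_apply]
    refine Finset.measurable_fun_sum _ fun k _ => ?_
    exact (continuous_star.measurable.comp
      ((measurable_unitaryGroup_apply k j).comp measurable_fst)).mul
      ((measurable_pi_apply k).comp measurable_snd)
  have hT : MeasurableSet {w : Fin N → ℂ | t * ∑ k, ‖w k‖ ^ 2 < ‖w j‖ ^ 2} :=
    measurableSet_lt (by fun_prop) (by fun_prop)
  have hfst : (μ.prod ν) S = ∫⁻ w in {w : Fin N → ℂ | t * ∑ k, ‖w k‖ ^ 2 < ‖w j‖ ^ 2}, g w := by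
    have hsec (U : Matrix.unitaryGroup (Fin N) ℂ) : ν (Prod.mk U ⁻¹' S)
        = ∫⁻ w in {w : Fin N → ℂ | t * ∑ k, ‖w k‖ ^ 2 < ‖w j‖ ^ 2}, g w := by
      have hm := measurePreserving_unitary_mulVec (U⁻¹)
      rw [withDensity_apply _ (measurable_prodMk_left hS),
        ← lintegral_indicator (measurable_prodMk_left hS), ← lintegral_indicator hT,
        ← hm.lintegral_comp (hg.indicator hT)]
      refine lintegral_congr fun w => ?_
      simp only [g, S, Set.indicator, Set.mem_preimage, Set.mem_ofPred_eq,
        sum_norm_sq_unitary_mulVec]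
      rfl
    rw [Measure.prod_apply hS]
    simp_rw [hsec]
    simp
  have hsnd : (μ.prod ν) S
      = μ {U | t < ‖(U : Matrix (Fin N) (Fin N) ℂ) i j‖ ^ 2} * ν Set.univ := by
    rw [Measure.prod_apply_symm hS, ← lintegral_const]
    have : Nonempty (Fin N) := ⟨i⟩
    -- The origin, where the ratio is undefined, is null because the space has positive dimension.
    have h0 : ∀ᵐ w ∂ν, w ≠ 0 :=
      (withDensity_absolutelyContinuous volume g).ae_le (Measure.ae_ne volume 0)
    refine lintegral_congr_ae ?_
    filter_upwards [h0] with w hw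
    exact haar_unitaryGroup_lt_norm_sq_conjTranspose_mulVec μ i j t hw
  rw [mul_comm, ← hfst, hsnd, withDensity_apply _ MeasurableSet.univ, setLIntegral_univ]

/-! ### The Beta law and its tail -/

theorem betaMeasure_one_sub_one {N : ℕ} (hN : 2 ≤ N) :
    betaMeasure 1 ((N : ℝ) - 1) = volume.withDensity fun p : ℝ =>
      (Set.Icc (0 : ℝ) 1).indicator
        (fun p => ENNReal.ofReal (((N : ℝ) - 1) * (1 - p) ^ (N - 2))) p := by
  obtain ⟨n, rfl⟩ := Nat.exists_eq_add_of_le' hN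
  refine withDensity_congr_ae ?_
  -- The endpoints are dropped: the Beta density is `0` there, while the closed-interval density is
  -- not at `0`, nor at `1` when `N = 2`.
  filter_upwards [Measure.ae_ne volume (0 : ℝ), Measure.ae_ne volume (1 : ℝ)] with p h0 h1
  have hn : ((n + 2 : ℕ) : ℝ) - 1 = (n : ℝ) + 1 := by push_cast; ring
  have hb : 1 / beta 1 ((n : ℝ) + 1) = (n : ℝ) + 1 := by
    have h1 : 0 < Real.Gamma ((n : ℝ) + 1) := Real.Gamma_pos_of_pos (by positivity)
    rw [beta, Real.Gamma_one, add_comm (1 : ℝ), Real.Gamma_add_one (s := (n : ℝ) + 1) (by positivity)]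
    field_simp
  by_cases h : 0 < p ∧ p < 1
  · rw [betaPDF_of_pos_lt_one h.1 h.2, Set.indicator_of_mem (Set.mem_Icc.2 ⟨h.1.le, h.2.le⟩), hn, hb]
    simp
  · rw [betaPDF_eq, if_neg h, Set.indicator_of_notMem, ENNReal.ofReal_zero]
    exact fun hp => h ⟨lt_of_le_of_ne hp.1 h0.symm, lt_of_le_of_ne hp.2 h1⟩

theorem betaMeasure_one_sub_one_Ioi {N : ℕ} (hN : 2 ≤ N) {t : ℝ} (ht : 0 ≤ t) (ht1 : t < 1) :
    betaMeasure 1 ((N : ℝ) - 1) (Set.Ioi t) = ENNReal.ofReal ((1 - t) ^ (N - 1)) := by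
  rw [betaMeasure_one_sub_one hN]
  obtain ⟨n, rfl⟩ := Nat.exists_eq_add_of_le' hN
  rw [withDensity_apply _ measurableSet_Ioi, lintegral_indicator measurableSet_Icc,
    Measure.restrict_restrict measurableSet_Icc]
  have hset : Set.Icc (0 : ℝ) 1 ∩ Set.Ioi t = Set.Ioc t 1 := by
    ext p
    simp only [Set.mem_inter_iff, Set.mem_Icc, Set.mem_Ioi, Set.mem_Ioc]
    constructor
    · rintro ⟨⟨_, h⟩, h'⟩; exact ⟨h', h⟩
    · rintro ⟨h, h'⟩; exact ⟨⟨by linarith, h'⟩, h⟩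
  have hd (p : ℝ) : HasDerivAt (fun x : ℝ => -(1 - x) ^ (n + 1))
      ((((n + 2 : ℕ) : ℝ) - 1) * (1 - p) ^ (n + 2 - 2)) p := by
    have := (((hasDerivAt_id p).const_sub 1).pow (n + 1)).neg
    exact this.congr_deriv (by push_cast [id, Nat.add_sub_cancel]; ring)
  have hc : Continuous fun p : ℝ => (((n + 2 : ℕ) : ℝ) - 1) * (1 - p) ^ (n + 2 - 2) := by fun_prop
  rw [hset, ← ofReal_integral_eq_lintegral_ofReal]
  · rw [← intervalIntegral.integral_of_le ht1.le,
      intervalIntegral.integral_eq_sub_of_hasDerivAt (fun p _ => hd p)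
        (hc.intervalIntegrable _ _)]
    simp
  · exact (hc.integrableOn_Icc (a := t) (b := 1)).mono_set Set.Ioc_subset_Icc_self
  · refine (ae_restrict_iff' measurableSet_Ioc).2 (Filter.Eventually.of_forall fun p hp => ?_)
    refine mul_nonneg (by push_cast; linarith [(Nat.cast_nonneg n : (0 : ℝ) ≤ n)])
      (pow_nonneg (by linarith [hp.2]) _)

theorem eq_betaMeasure_one_sub_one_of_Ioi {N : ℕ} (hN : 2 ≤ N) (ρ : Measure ℝ)
    [IsProbabilityMeasure ρ] (hsupp : ∀ᵐ p ∂ρ, p ∈ Set.Icc (0 : ℝ) 1)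
    (htail : ∀ t : ℝ, 0 ≤ t → t < 1 → ρ (Set.Ioi t) = ENNReal.ofReal ((1 - t) ^ (N - 1))) :
    ρ = betaMeasure 1 ((N : ℝ) - 1) := by
  have hN' : (2 : ℝ) ≤ N := by exact_mod_cast hN
  have : IsProbabilityMeasure (betaMeasure 1 ((N : ℝ) - 1)) :=
    isProbabilityMeasureBeta one_pos (by linarith)
  have hsupp' : ∀ᵐ p ∂(betaMeasure 1 ((N : ℝ) - 1)), p ∈ Set.Icc (0 : ℝ) 1 := by
    rw [betaMeasure_one_sub_one hN, ae_withDensity_iff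
      (Measurable.indicator (by fun_prop) measurableSet_Icc)]
    exact Filter.Eventually.of_forall fun p hp => Set.mem_of_indicator_ne_zero hp
  have hlow (σ : Measure ℝ) (hσ : ∀ᵐ p ∂σ, p ∈ Set.Icc (0 : ℝ) 1) {t : ℝ} (ht : t < 0) :
      σ (Set.Iic t) = 0 := by
    refine measure_eq_zero_iff_ae_notMem.2 (hσ.mono fun p hp hp' => ?_)
    exact absurd (hp.1.trans hp') (not_le.2 ht)
  have hhigh (σ : Measure ℝ) (hσ : ∀ᵐ p ∂σ, p ∈ Set.Icc (0 : ℝ) 1) {t : ℝ} (ht : 1 ≤ t) :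
      σ (Set.Ioi t) = 0 := by
    refine measure_eq_zero_iff_ae_notMem.2 (hσ.mono fun p hp hp' => ?_)
    exact absurd (hp.2.trans ht) (not_le.2 hp')
  refine Measure.ext_of_Iic _ _ fun t => ?_
  rcases lt_or_ge t 0 with ht | ht
  · rw [hlow _ hsupp ht, hlow _ hsupp' ht]
  rw [← Set.compl_Ioi, prob_compl_eq_one_sub measurableSet_Ioi,
    prob_compl_eq_one_sub measurableSet_Ioi]
  rcases lt_or_ge t 1 with ht1 | ht1
  · rw [htail t ht ht1, betaMeasure_one_sub_one_Ioi hN ht ht1]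
  · rw [hhigh _ hsupp ht1, hhigh _ hsupp' ht1]

/-- The squared modulus of an entry of a Haar unitary matrix has tail `(1 - t) ^ (N - 1)`. -/
theorem haar_unitaryGroup_lt_norm_sq {N : ℕ} [MeasurableSpace (Matrix.unitaryGroup (Fin N) ℂ)]
    [BorelSpace (Matrix.unitaryGroup (Fin N) ℂ)]
    (μ : Measure (Matrix.unitaryGroup (Fin N) ℂ)) [μ.IsMulLeftInvariant] [IsProbabilityMeasure μ]
    (i j : Fin N) {t : ℝ} (ht : 0 ≤ t) (ht1 : t < 1) :
    μ {U | t < ‖(U : Matrix (Fin N) (Fin N) ℂ) i j‖ ^ 2} = ENNReal.ofReal ((1 - t) ^ (N - 1)) := by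
  obtain ⟨n, rfl⟩ : ∃ n, N = n + 1 := Nat.exists_eq_succ_of_ne_zero (Fin.pos i).ne'
  have h := lintegral_exp_mul_haar_unitaryGroup_lt_norm_sq μ i j t
  have hG := lintegral_exp_neg_mul_sum_norm_sq (n + 1) one_pos
  simp only [neg_mul, one_mul, div_one] at hG
  have hpi : 0 < Real.pi ^ (n + 1) := by positivity
  rw [setLIntegral_exp_neg_sum_norm_sq_cone n j ht ht1, hG, ENNReal.ofReal_mul hpi.le] at h
  exact (ENNReal.mul_right_inj (ENNReal.ofReal_pos.2 hpi).ne' ENNReal.ofReal_ne_top).1 h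

theorem mainTheorem8 {N : ℕ} (hN : 2 ≤ N)
    [MeasurableSpace (Matrix.unitaryGroup (Fin N) ℂ)]
    [BorelSpace (Matrix.unitaryGroup (Fin N) ℂ)]
    (μ : Measure (Matrix.unitaryGroup (Fin N) ℂ)) [μ.IsHaarMeasure] [IsProbabilityMeasure μ]
    {Ω : Type*} [MeasurableSpace Ω] (P : Measure Ω)
    (U : Ω → Matrix.unitaryGroup (Fin N) ℂ) (hU : HasLaw U μ P)
    (i j : Fin N) :
    HasLaw (fun ω => ‖(U ω : Matrix (Fin N) (Fin N) ℂ) i j‖ ^ 2) (betaMeasure 1 ((N : ℝ) - 1)) P ∧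
    HasLaw (fun ω => ‖(U ω : Matrix (Fin N) (Fin N) ℂ) i j‖ ^ 2)
      (volume.withDensity fun p : ℝ =>
        (Set.Icc (0 : ℝ) 1).indicator
          (fun p => ENNReal.ofReal (((N : ℝ) - 1) * (1 - p) ^ (N - 2))) p) P := by
  have hm : Measurable fun V : Matrix.unitaryGroup (Fin N) ℂ =>
      ‖(V : Matrix (Fin N) (Fin N) ℂ) i j‖ ^ 2 :=
    (measurable_unitaryGroup_apply i j).norm.pow_const 2
  have hlaw : HasLaw (fun V : Matrix.unitaryGroup (Fin N) ℂ =>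
      ‖(V : Matrix (Fin N) (Fin N) ℂ) i j‖ ^ 2) (betaMeasure 1 ((N : ℝ) - 1)) μ := by
    refine ⟨hm.aemeasurable, ?_⟩
    have := Measure.isProbabilityMeasure_map (μ := μ) hm.aemeasurable
    refine eq_betaMeasure_one_sub_one_of_Ioi hN _ ?_ fun t ht ht1 => ?_
    · refine (ae_map_iff hm.aemeasurable measurableSet_Icc).2 ?_
      exact Filter.Eventually.of_forall fun V =>
        ⟨by positivity, pow_le_one₀ (norm_nonneg _) (entry_norm_bound_of_unitary V.2 i j)⟩
    · rw [Measure.map_apply hm measurableSet_Ioi]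
      exact haar_unitaryGroup_lt_norm_sq μ i j ht ht1
  have hbeta := hlaw.fun_comp hU
  exact ⟨hbeta, betaMeasure_one_sub_one hN ▸ hbeta⟩
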